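/- Let $m_1\ge 2$ and $m_2\ge 1$ be integers, and let $G=(V,E)$ be the graph formed by joining a cycle of length $2m_1$ and a cycle of length $2m_2+1$ along a shared edge, i.e. $G$ is the union of two subgraphs that are cycles of these lengths and whose intersection is a single edge with its two endpoints. Let $\nabla_G=\{\pm(\mathbf e_i-\mathbf e_j) : \{i,j\}\in E\}\subset\mathbb R^{V}$ be the point configuration whose convex hull is the adjacency polytope (symmetric edge polytope) of $G$. A facet of $\nabla_G$ is a subset $F\subseteq\nabla_G$ such that $\operatorname{conv}(F)$ is a facet (maximal proper face) of $\operatorname{conv}(\nabla_G)$, and its corank is $|F|-\dim(\operatorname{conv} F)-1$. Then the number of facets of $\nabla_G$ is $$\left[(2m_1-1)\binom{2m_1-2}{m_1-1}+2m_2\binom{2m_1-1}{m_1}\right]\binom{2m_2}{m_2}.$$ Moreover, every facet of $\nabla_G$ has corank $0$ or $1$; exactly $(2m_1-1)\binom{2m_1-2}{m_1-1}\binom{2m_2}{m_2}$ facets have corank $0$, and exactly $2m_2\binom{2m_1-1}{m_1}\binom{2m_2}{m_2}$ facets have corank $1$. -/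

import Mathlib

/-- The faces of a polytope `P` are its exposed subsets (`IsExposed ℝ P F`: the empty set, or the set
of points of `P` at which some linear functional is optimal over `P`). A facet is a maximal element
among the faces different from `P`. -/
def IsPolytopeFacet {E : Type*} [AddCommGroup E] [Module ℝ E] [TopologicalSpace E]
    (P F : Set E) : Prop :=
  Maximal (fun F' : Set E => IsExposed ℝ P F' ∧ F' ≠ P) F

/-- The facets of a point configuration `X`: the subsets `F` of `X` such that `conv F` is a facet of
`conv X`. -/
def configFacets {E : Type*} [AddCommGroup E] [Module ℝ E] [TopologicalSpace E]
    (X : Set E) : Set (Set E) :=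
  {F | F ⊆ X ∧ IsPolytopeFacet (convexHull ℝ X) (convexHull ℝ F)}

/-- The dimension of a point configuration: the dimension of the affine span of its convex hull. -/
noncomputable def configDim {E : Type*} [AddCommGroup E] [Module ℝ E] (X : Set E) : ℕ :=
  Module.finrank ℝ (affineSpan ℝ (convexHull ℝ X)).direction

/-- The corank `|X| - dim X - 1` of a (finite) point configuration. -/
noncomputable def configCorank {E : Type*} [AddCommGroup E] [Module ℝ E] (X : Set E) : ℤ :=
  (X.ncard : ℤ) - (configDim X : ℤ) - 1

/-- The point configuration `{± (e_i - e_j) | {i, j} an edge of G}` in `ℝ^V`, whose convex hull is the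
adjacency polytope (symmetric edge polytope) of `G`. Both signs occur since adjacency is symmetric. -/
def adjacencyConfig {V : Type*} [DecidableEq V] (G : SimpleGraph V) : Set (V → ℝ) :=
  {x | ∃ i j : V, G.Adj i j ∧ x = Pi.single i 1 - Pi.single j 1}

/-- `G` is formed by joining a cycle of length `k` and a cycle of length `l` along a shared edge:
it is the union of two subgraphs that are cycles of these lengths and whose intersection consists of
a single edge together with its two endpoints. -/
def IsCycleEdgeJoin {V : Type*} (G : SimpleGraph V) (k l : ℕ) : Prop :=
  ∃ C₁ C₂ : G.Subgraph,
    Nonempty (C₁.coe ≃g SimpleGraph.cycleGraph k) ∧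
    Nonempty (C₂.coe ≃g SimpleGraph.cycleGraph l) ∧
    C₁ ⊔ C₂ = ⊤ ∧
    ∃ (u v : V) (h : G.Adj u v), C₁ ⊓ C₂ = G.subgraphOfAdj h

/-! A nonempty proper face of the polytope is the locus where some functional attains its maximum
over the polytope. By central symmetry that maximum is positive, so it can be scaled to 1. Such a
functional is a potential `f` on the vertices with `f i - f j ≤ 1` along every edge, and the face is
spanned by the edges where equality holds, suitably oriented. If these tight edges do not connect
the graph, `f` can be shifted on one component until a further edge becomes tight. If they do, `f`
is determined up to a constant. So facets are exactly the tight sets of feasible potentials with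
connected tight graph (`mem_configFacets_adjacencyConfig_iff`), and each has dimension `|V| - 2`
(`configDim_tightSet`).

The joined graph is a Hamiltonian cycle of odd length `L = 2m₁ + 2m₂ - 1` with a chord cutting off
an arc of `k = 2m₁ - 1` edges. Connectedness makes all differences of `f` integers, so each cycle
edge has a step in `{-1, 0, 1}`. The steps sum to zero and `L` is odd, so the number of zero steps
is odd. Two zeros on one side of the chord would disconnect the tight graph, so there are at most
two, hence exactly one (`exists_isBalanced`). Facets thus correspond to sequences with one zero
whose sum over the whole cycle is 0 and whose height at the chord is at most 1 in absolute value.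

There are `L - 1` tight cycle edges, and the chord is tight exactly when its height is `±1`, so the
corank is the absolute height. Since `k` is odd, height 0 puts the zero step on the first arc and
height `±1` puts it on the second. Counting the signs on each arc gives the binomial coefficients.
-/

section ConvexFaces

/-! ### Faces of convex hulls -/

variable {E : Type*} [AddCommGroup E] [Module ℝ E]

/-- A face of a convex hull cut out by a valid inequality is the hull of the generators on it. -/
theorem convexHull_inter_level_eq (X : Set E) (l : E →ₗ[ℝ] ℝ) (M : ℝ) (h : ∀ x ∈ X, l x ≤ M) :
    {x ∈ convexHull ℝ X | l x = M} = convexHull ℝ {x ∈ X | l x = M} := by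
  have hlev : ∀ x ∈ convexHull ℝ {x ∈ X | l x = M}, l x = M := fun x hx => by
    refine convexHull_min (t := {x | l x = M}) (fun y hy => hy.2) ?_ hx
    exact convex_hyperplane l.isLinear M
  apply Set.Subset.antisymm
  · rintro x ⟨hx, hxM⟩
    -- This union contains `X`, so once it is convex it contains the whole hull; a point at level
    -- `M` must then lie in the second piece.
    have hconv : Convex ℝ ({x | l x < M} ∪ convexHull ℝ {x ∈ X | l x = M}) := by
      have hle : ∀ z ∈ ({x | l x < M} ∪ convexHull ℝ {x ∈ X | l x = M}), l z ≤ M := by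
        rintro z (hz | hz)
        · exact le_of_lt hz
        · exact (hlev z hz).le
      intro y hy z hz a b ha hb hab
      rcases ha.eq_or_lt with rfl | ha'
      · have : b = 1 := by linarith
        subst this; simpa using hz
      rcases hb.eq_or_lt with rfl | hb'
      · have : a = 1 := by linarith
        subst this; simpa using hy
      have hly := hle y hy
      have hlz := hle z hz
      by_cases h1 : l y < M
      · left
        simp only [Set.mem_ofPred_eq, map_add, map_smul, smul_eq_mul]
        have h3 := mul_lt_mul_of_pos_left h1 ha'
        have h4 := mul_le_mul_of_nonneg_left hlz hb
        have h5 : a * M + b * M = M := by rw [← add_mul, hab, one_mul]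
        linarith
      by_cases h2 : l z < M
      · left
        simp only [Set.mem_ofPred_eq, map_add, map_smul, smul_eq_mul]
        have h3 := mul_le_mul_of_nonneg_left hly ha
        have h4 := mul_lt_mul_of_pos_left h2 hb'
        have h5 : a * M + b * M = M := by rw [← add_mul, hab, one_mul]
        linarith
      right
      exact convex_convexHull ℝ _ (hy.resolve_left h1) (hz.resolve_left h2) ha hb hab
    have := convexHull_min (s := X) (fun y hy => by
      rcases (h y hy).lt_or_eq with h' | h'
      · exact Or.inl h'
      · exact Or.inr (subset_convexHull ℝ _ ⟨hy, h'⟩)) hconv hx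
    rcases this with h' | h'
    · exact absurd hxM (ne_of_lt h')
    · exact h'
  · intro x hx
    exact ⟨convexHull_mono (fun y hy => hy.1) hx, hlev x hx⟩

theorem map_le_of_mem_convexHull {X : Set E} {l : E →ₗ[ℝ] ℝ} {M : ℝ} (h : ∀ x ∈ X, l x ≤ M)
    {x : E} (hx : x ∈ convexHull ℝ X) : l x ≤ M :=
  convexHull_min (t := {x | l x ≤ M}) h (convex_halfSpace_le l.isLinear M) hx

end ConvexFaces

/-! ### Facets of the adjacency polytope as tight sets of potentials -/

section TightSets

variable {V : Type*}

/-- A potential whose differences along edges are at most one. -/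
def IsFeasible (G : SimpleGraph V) (f : V → ℝ) : Prop :=
  ∀ i j, G.Adj i j → f i - f j ≤ 1

/-- The edges along which a potential changes by exactly one. -/
def tightGraph (G : SimpleGraph V) (f : V → ℝ) : SimpleGraph V where
  Adj i j := G.Adj i j ∧ (f i - f j = 1 ∨ f j - f i = 1)
  symm := ⟨fun _ _ h => ⟨h.1.symm, h.2.symm⟩⟩
  loopless := ⟨fun _ h => G.loopless.irrefl _ h.1⟩

/-- Constant ratios along tight edges propagate along a connected tight graph. -/
theorem sub_eq_of_tight {G : SimpleGraph V} {f g : V → ℝ} {M : ℝ} (hT : (tightGraph G f).Connected)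
    (h : ∀ i j, G.Adj i j → f i - f j = 1 → g i - g j = M) (i j : V) :
    g i - g j = M * (f i - f j) := by
  obtain ⟨w⟩ := hT.preconnected i j
  induction w with
  | nil => simp
  | cons hadj _ ih =>
    rcases hadj.2 with h' | h'
    · have := h _ _ hadj.1 h'
      linear_combination ih + this - M * h'
    · have := h _ _ hadj.1.symm h'
      linear_combination ih - this + M * h'

variable [DecidableEq V]

/-- The points of the configuration on the hyperplane given by a potential. -/
def tightSet (G : SimpleGraph V) (f : V → ℝ) : Set (V → ℝ) :=
  {x | ∃ i j : V, G.Adj i j ∧ f i - f j = 1 ∧ x = Pi.single i 1 - Pi.single j 1}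

theorem tightSet_subset (G : SimpleGraph V) (f : V → ℝ) : tightSet G f ⊆ adjacencyConfig G := by
  rintro x ⟨i, j, h, -, rfl⟩
  exact ⟨i, j, h, rfl⟩

theorem single_sub_single_inj {i j k l : V} (hij : i ≠ j)
    (h : (Pi.single i 1 - Pi.single j 1 : V → ℝ) = Pi.single k 1 - Pi.single l 1) :
    i = k ∧ j = l := by
  have hi := congrFun h i
  have hj := congrFun h j
  simp only [Pi.sub_apply, Pi.single_apply] at hi hj
  constructor
  · by_contra hne
    simp only [hij, hne, if_true, if_false] at hi
    split_ifs at hi <;> norm_num at hi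
  · by_contra hne
    simp only [hij.symm, hne, if_true, if_false] at hj
    split_ifs at hj <;> norm_num at hj

theorem single_sub_single_mem_tightSet {G : SimpleGraph V} {f : V → ℝ} {i j : V} :
    (Pi.single i 1 - Pi.single j 1 : V → ℝ) ∈ tightSet G f ↔ G.Adj i j ∧ f i - f j = 1 := by
  constructor
  · rintro ⟨k, l, h, hf, he⟩
    obtain ⟨rfl, rfl⟩ := single_sub_single_inj h.ne he.symm
    exact ⟨h, hf⟩
  · rintro ⟨h, hf⟩
    exact ⟨i, j, h, hf, rfl⟩

/-- Potentials as functionals. -/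
noncomputable def potentialFunctional [Fintype V] (f : V → ℝ) : StrongDual ℝ (V → ℝ) :=
  ∑ i, f i • ContinuousLinearMap.proj i

theorem potentialFunctional_single [Fintype V] (f : V → ℝ) (i : V) :
    potentialFunctional f (Pi.single i 1) = f i := by
  simp [potentialFunctional, Pi.single_apply]

theorem potentialFunctional_sub [Fintype V] (f : V → ℝ) (i j : V) :
    potentialFunctional f (Pi.single i 1 - Pi.single j 1) = f i - f j := by
  rw [map_sub, potentialFunctional_single, potentialFunctional_single]

variable {G : SimpleGraph V} {f : V → ℝ}

theorem potentialFunctional_le [Fintype V] (hf : IsFeasible G f) :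
    ∀ x ∈ adjacencyConfig G, potentialFunctional f x ≤ 1 := by
  rintro x ⟨i, j, h, rfl⟩
  rw [potentialFunctional_sub]
  exact hf i j h

theorem sep_adjacencyConfig_eq_tightSet (l : (V → ℝ) →ₗ[ℝ] ℝ) {M : ℝ} (hM : M ≠ 0) :
    {x ∈ adjacencyConfig G | l x = M} = tightSet G (fun i => l (Pi.single i 1) / M) := by
  ext x
  constructor
  · rintro ⟨⟨i, j, h, rfl⟩, hl⟩
    refine ⟨i, j, h, ?_, rfl⟩
    rw [← sub_div, ← map_sub, hl, div_self hM]
  · rintro ⟨i, j, h, hl, rfl⟩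
    refine ⟨⟨i, j, h, rfl⟩, ?_⟩
    rw [← sub_div, ← map_sub, div_eq_one_iff_eq hM] at hl
    exact hl

theorem convexHull_tightSet_eq_level [Fintype V] (hf : IsFeasible G f) :
    convexHull ℝ (tightSet G f) =
      {x ∈ convexHull ℝ (adjacencyConfig G) | potentialFunctional f x = 1} := by
  have h1 := sep_adjacencyConfig_eq_tightSet (G := G)
    (potentialFunctional f : (V → ℝ) →ₗ[ℝ] ℝ) one_ne_zero
  have h2 := convexHull_inter_level_eq (adjacencyConfig G)
    (potentialFunctional f : (V → ℝ) →ₗ[ℝ] ℝ) 1 (potentialFunctional_le hf)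
  simp only [ContinuousLinearMap.coe_coe, potentialFunctional_single, div_one] at h1 h2
  rw [h2, h1]

theorem isExposed_convexHull_tightSet [Fintype V] (hf : IsFeasible G f) :
    IsExposed ℝ (convexHull ℝ (adjacencyConfig G)) (convexHull ℝ (tightSet G f)) := by
  intro hne
  refine ⟨potentialFunctional f, ?_⟩
  have hle : ∀ x ∈ convexHull ℝ (adjacencyConfig G), potentialFunctional f x ≤ 1 := fun x hx =>
    map_le_of_mem_convexHull (l := (potentialFunctional f : (V → ℝ) →ₗ[ℝ] ℝ))
      (potentialFunctional_le hf) hx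
  rw [convexHull_tightSet_eq_level hf] at hne ⊢
  obtain ⟨b, hb, hb1⟩ := hne
  ext x
  constructor
  · rintro ⟨hx, hx1⟩
    exact ⟨hx, fun y hy => hx1 ▸ hle y hy⟩
  · rintro ⟨hx, hx1⟩
    exact ⟨hx, le_antisymm (hle x hx) (hb1 ▸ hx1 b hb)⟩

theorem neg_mem_adjacencyConfig {x : V → ℝ} (hx : x ∈ adjacencyConfig G) :
    -x ∈ adjacencyConfig G := by
  obtain ⟨i, j, h, rfl⟩ := hx
  exact ⟨j, i, h.symm, by simp⟩

/-- The configuration is centrally symmetric, so the functional cannot equal 1 at both `x` and `-x`.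
-/
theorem convexHull_tightSet_ne [Fintype V] (hf : IsFeasible G f) (hne : (adjacencyConfig G).Nonempty) :
    convexHull ℝ (tightSet G f) ≠ convexHull ℝ (adjacencyConfig G) := by
  intro h
  rw [convexHull_tightSet_eq_level hf] at h
  obtain ⟨x, hx⟩ := hne
  have h1 : x ∈ convexHull ℝ (adjacencyConfig G) := subset_convexHull ℝ _ hx
  have h2 : -x ∈ convexHull ℝ (adjacencyConfig G) :=
    subset_convexHull ℝ _ (neg_mem_adjacencyConfig hx)
  rw [← h] at h1 h2
  have := h1.2
  have := h2.2
  rw [map_neg] at this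
  linarith

/-- Every nonempty proper face is cut out by a feasible potential. -/
theorem exists_isFeasible_of_isExposed [Fintype V] {B : Set (V → ℝ)}
    (hB : IsExposed ℝ (convexHull ℝ (adjacencyConfig G)) B)
    (hne : B.Nonempty) (hB' : B ≠ convexHull ℝ (adjacencyConfig G)) :
    ∃ f, IsFeasible G f ∧ B = convexHull ℝ (tightSet G f) := by
  obtain ⟨l, hl⟩ := hB hne
  obtain ⟨b, hb⟩ := hne
  have hb' := hb
  rw [hl] at hb'
  obtain ⟨hbP, hmax⟩ := hb'
  have hX : ∀ x ∈ adjacencyConfig G, l x ≤ l b := fun x hx => hmax x (subset_convexHull ℝ _ hx)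
  have hBM : B = {x ∈ convexHull ℝ (adjacencyConfig G) | l x = l b} := by
    rw [hl]
    ext x
    constructor
    · rintro ⟨hx, hx'⟩
      exact ⟨hx, le_antisymm (hmax x hx) (hx' b hbP)⟩
    · rintro ⟨hx, hx'⟩
      exact ⟨hx, fun y hy => hx' ▸ hmax y hy⟩
  have hXne : (adjacencyConfig G).Nonempty := convexHull_nonempty_iff.1 ⟨b, hbP⟩
  obtain ⟨x₀, hx₀⟩ := hXne
  have h0 : 0 ≤ l b := by
    have h1 := hX _ hx₀
    have h2 := hX _ (neg_mem_adjacencyConfig hx₀)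
    rw [map_neg] at h2
    linarith
  -- If the maximum were 0, symmetry would make the functional vanish on the whole polytope, and the
  -- face would not be proper.
  have hpos : 0 < l b := by
    refine lt_of_le_of_ne h0 fun h => hB' ?_
    rw [hBM, ← h]
    refine Set.Subset.antisymm (fun x hx => hx.1) fun x hx => ⟨hx, ?_⟩
    have h1 := map_le_of_mem_convexHull (l := (l : (V → ℝ) →ₗ[ℝ] ℝ)) (M := 0)
      (fun y hy => by simpa [h] using hX y hy) hx
    have h2 := map_le_of_mem_convexHull (l := -(l : (V → ℝ) →ₗ[ℝ] ℝ)) (M := 0)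
      (fun y hy => by simpa [h] using hX _ (neg_mem_adjacencyConfig hy)) hx
    simp only [ContinuousLinearMap.coe_coe, LinearMap.neg_apply] at h1 h2
    linarith
  refine ⟨fun i => l (Pi.single i 1) / l b, ?_, ?_⟩
  · intro i j h
    rw [← sub_div, ← map_sub, div_le_one hpos]
    exact hX _ ⟨i, j, h, rfl⟩
  · rw [hBM]
    have h1 := sep_adjacencyConfig_eq_tightSet (G := G) (l : (V → ℝ) →ₗ[ℝ] ℝ) hpos.ne'
    have h2 := convexHull_inter_level_eq (adjacencyConfig G) (l : (V → ℝ) →ₗ[ℝ] ℝ) (l b) hX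
    simp only [ContinuousLinearMap.coe_coe] at h1 h2
    rw [h2, h1]

/-- The points of the configuration are in convex position. -/
theorem mem_of_mem_convexHull_subset [Fintype V] {F : Set (V → ℝ)} (hF : F ⊆ adjacencyConfig G)
    {x : V → ℝ} (hx : x ∈ adjacencyConfig G) (hxF : x ∈ convexHull ℝ F) : x ∈ F := by
  by_contra hn
  obtain ⟨i, j, h, rfl⟩ := hx
  have hij := h.ne
  -- The functional `e_i - e_j` takes the value 2 at the point `e_i - e_j` and at most 1 at every
  -- other point of the configuration.
  have key : ∀ y ∈ F, (potentialFunctional (Pi.single i 1 - Pi.single j 1 : V → ℝ) :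
      (V → ℝ) →ₗ[ℝ] ℝ) y ≤ 1 := by
    intro y hy
    obtain ⟨a, b, hab, rfl⟩ := hF hy
    rw [ContinuousLinearMap.coe_coe, potentialFunctional_sub]
    have hne := hab.ne
    have : ¬ (a = i ∧ b = j) := by
      rintro ⟨rfl, rfl⟩
      exact hn hy
    simp only [Pi.sub_apply, Pi.single_apply]
    split_ifs <;> simp_all <;> norm_num
  have := map_le_of_mem_convexHull key hxF
  rw [ContinuousLinearMap.coe_coe, potentialFunctional_sub] at this
  simp [hij, hij.symm] at this
  norm_num at this

theorem eq_tightSet_of_convexHull_eq [Fintype V] {F : Set (V → ℝ)} (hF : F ⊆ adjacencyConfig G)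
    (h : convexHull ℝ F = convexHull ℝ (tightSet G f)) : F = tightSet G f := by
  apply Set.Subset.antisymm
  · intro x hx
    exact mem_of_mem_convexHull_subset (tightSet_subset G f) (hF hx)
      (h ▸ subset_convexHull ℝ _ hx)
  · intro x hx
    exact mem_of_mem_convexHull_subset hF (tightSet_subset G f hx)
      (h ▸ subset_convexHull ℝ _ hx)

/-- A potential with disconnected tight graph can be improved. -/
theorem exists_tightSet_ssubset [Fintype V] (hG : G.Connected) (hf : IsFeasible G f)
    (hT : ¬ (tightGraph G f).Connected) :
    ∃ f', IsFeasible G f' ∧ tightSet G f ⊂ tightSet G f' := by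
  classical
  have hpre : ¬ (tightGraph G f).Preconnected := fun h =>
    hT (SimpleGraph.connected_iff _ |>.2 ⟨h, hG.nonempty⟩)
  simp only [SimpleGraph.Preconnected, not_forall] at hpre
  obtain ⟨a, b, hab⟩ := hpre
  -- Raise `f` on the tight component `S` of `a` by the least slack `t` of an edge leaving `S`. No
  -- tight edge crosses the boundary of `S`, so all stay tight, and an edge of least slack becomes
  -- tight.
  set S : Set V := {x | (tightGraph G f).Reachable a x} with hS
  have hcross : ∀ i j, (tightGraph G f).Adj i j → (i ∈ S ↔ j ∈ S) := fun i j h =>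
    ⟨fun hi => SimpleGraph.Reachable.trans hi h.reachable,
      fun hj => SimpleGraph.Reachable.trans hj h.symm.reachable⟩
  let E : Finset (V × V) := Finset.univ.filter fun p => G.Adj p.1 p.2 ∧ p.1 ∈ S ∧ p.2 ∉ S
  have hE : E.Nonempty := by
    obtain ⟨w⟩ := hG.preconnected a b
    obtain ⟨d, -, h1, h2⟩ := w.exists_boundary_dart S SimpleGraph.Reachable.rfl hab
    exact ⟨d.toProd, by simp [E, h1, h2, d.adj]⟩
  obtain ⟨p, hp, hmin⟩ := E.exists_min_image (fun p => 1 - (f p.1 - f p.2)) hE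
  simp only [E, Finset.mem_filter, Finset.mem_univ, true_and] at hp hmin
  obtain ⟨hpadj, hp1, hp2⟩ := hp
  set t := 1 - (f p.1 - f p.2) with ht
  have ht0 : 0 ≤ t := by have := hf _ _ hpadj; linarith
  have htne : f p.1 - f p.2 ≠ 1 := fun h => hp2 ((hcross _ _ ⟨hpadj, Or.inl h⟩).1 hp1)
  refine ⟨fun x => f x + if x ∈ S then t else 0, ?_, ?_⟩
  · intro i j h
    have hfij := hf i j h
    by_cases hi : i ∈ S <;> by_cases hj : j ∈ S <;> simp only [hi, hj, if_true, if_false]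
    · linarith
    · have := hmin (i, j) ⟨h, hi, hj⟩
      simp only at this
      linarith
    · linarith
    · linarith
  · refine ⟨?_, ?_⟩
    · rintro x ⟨i, j, h, hij, rfl⟩
      refine ⟨i, j, h, ?_, rfl⟩
      have := hcross i j ⟨h, Or.inl hij⟩
      by_cases hi : i ∈ S
      · simp only [hi, this.1 hi, if_true]; linarith
      · have hj : j ∉ S := fun hj => hi (this.2 hj)
        simp only [hi, hj, if_false]; linarith
    · intro hsub
      have hmem := hsub (single_sub_single_mem_tightSet.2 ⟨hpadj, by
        simp only [hp1, hp2, if_true, if_false]; linarith⟩)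
      exact htne (single_sub_single_mem_tightSet.1 hmem).2

/-- A connected tight graph fixes the potential up to an additive constant, so such a tight set is
maximal among tight sets. -/
theorem tightSet_subset_inj (hT : (tightGraph G f).Connected) {g : V → ℝ}
    (h : tightSet G f ⊆ tightSet G g) : tightSet G g = tightSet G f := by
  refine Set.Subset.antisymm ?_ h
  have key := sub_eq_of_tight (M := 1) (g := g) hT fun i j hadj hij =>
    (single_sub_single_mem_tightSet.1 (h (single_sub_single_mem_tightSet.2 ⟨hadj, hij⟩))).2
  rintro x ⟨i, j, hadj, hij, rfl⟩
  exact ⟨i, j, hadj, by rw [← hij, key]; ring, rfl⟩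

theorem adjacencyConfig_nonempty [Nontrivial V] (hG : G.Connected) :
    (adjacencyConfig G).Nonempty := by
  obtain ⟨i⟩ := hG.nonempty
  obtain ⟨j, hj⟩ := hG.preconnected.exists_adj_of_nontrivial i
  exact ⟨_, i, j, hj, rfl⟩

theorem tightSet_nonempty [Nontrivial V] (hT : (tightGraph G f).Connected) :
    (tightSet G f).Nonempty := by
  obtain ⟨i⟩ := hT.nonempty
  obtain ⟨j, hj⟩ := hT.preconnected.exists_adj_of_nontrivial i
  rcases hj.2 with h | h
  · exact ⟨_, i, j, hj.1, h, rfl⟩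
  · exact ⟨_, j, i, hj.1.symm, h, rfl⟩

/-- Facets correspond to feasible potentials with connected tight graph. -/
theorem mem_configFacets_adjacencyConfig_iff [Fintype V] [Nontrivial V] (hG : G.Connected)
    {F : Set (V → ℝ)} :
    F ∈ configFacets (adjacencyConfig G) ↔
      ∃ f, IsFeasible G f ∧ (tightGraph G f).Connected ∧ F = tightSet G f := by
  have hX := adjacencyConfig_nonempty hG
  constructor
  · rintro ⟨hF, ⟨hexp, hne⟩, hmax⟩
    -- The empty set also counts as a face; it is not maximal, because an indicator potential cuts
    -- out a nonempty proper face.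
    have hFne : (convexHull ℝ F).Nonempty := by
      by_contra hemp
      rw [Set.not_nonempty_iff_eq_empty] at hemp
      obtain ⟨x, i, j, h, rfl⟩ := hX
      have hfeas : IsFeasible G (Pi.single i 1 : V → ℝ) := by
        intro a b _
        simp only [Pi.single_apply]
        split_ifs <;> norm_num
      have := hmax (y := convexHull ℝ (tightSet G (Pi.single i 1)))
        ⟨isExposed_convexHull_tightSet hfeas, convexHull_tightSet_ne hfeas ⟨_, i, j, h, rfl⟩⟩
        (by rw [hemp]; exact Set.empty_subset _)
        (subset_convexHull ℝ _ (single_sub_single_mem_tightSet.2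
          ⟨h, by simp [h.ne']⟩))
      rw [hemp] at this
      exact this
    obtain ⟨f, hf, hFf⟩ := exists_isFeasible_of_isExposed hexp hFne hne
    have hFeq := eq_tightSet_of_convexHull_eq hF hFf
    refine ⟨f, hf, ?_, hFeq⟩
    by_contra hT
    obtain ⟨f', hf', hsub⟩ := exists_tightSet_ssubset hG hf hT
    have hle : convexHull ℝ F ⊆ convexHull ℝ (tightSet G f') := by
      rw [hFeq]; exact convexHull_mono hsub.1
    have := hmax ⟨isExposed_convexHull_tightSet hf', convexHull_tightSet_ne hf' hX⟩ hle
    have heq := eq_tightSet_of_convexHull_eq hF (Set.Subset.antisymm hle this)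
    exact hsub.ne (hFeq.symm.trans heq)
  · rintro ⟨f, hf, hT, rfl⟩
    refine ⟨tightSet_subset G f, ⟨isExposed_convexHull_tightSet hf,
      convexHull_tightSet_ne hf hX⟩, ?_⟩
    rintro B ⟨hB, hBne⟩ hle
    obtain ⟨x, hx⟩ := tightSet_nonempty hT
    obtain ⟨g, -, rfl⟩ := exists_isFeasible_of_isExposed hB ⟨x, hle (subset_convexHull ℝ _ hx)⟩ hBne
    have : tightSet G f ⊆ tightSet G g := fun y hy =>
      mem_of_mem_convexHull_subset (tightSet_subset G g) (tightSet_subset G f hy)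
        (hle (subset_convexHull ℝ _ hy))
    rw [tightSet_subset_inj hT this]

/-- The dimension of a facet. -/
theorem configDim_tightSet [Fintype V] [Nontrivial V] (hT : (tightGraph G f).Connected) :
    configDim (tightSet G f) + 2 = Fintype.card V := by
  have hdir : (affineSpan ℝ (convexHull ℝ (tightSet G f))).direction =
      vectorSpan ℝ (tightSet G f) := by
    rw [affineSpan_convexHull, direction_affineSpan]
  obtain ⟨x₀, hx₀⟩ := tightSet_nonempty hT
  obtain ⟨i₀, j₀, hadj₀, h₀, -⟩ := id hx₀
  let φ : (V → ℝ) → Module.Dual ℝ (V → ℝ) := fun f => (potentialFunctional f : (V → ℝ) →ₗ[ℝ] ℝ)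
  have hφ : ∀ (f : V → ℝ) i, φ f (Pi.single i 1) = f i := potentialFunctional_single
  -- A functional constant on the tight set is a multiple of `f` plus a constant potential, by
  -- propagation along tight edges. The direction space therefore has codimension 2.
  have hann : (vectorSpan ℝ (tightSet G f)).dualAnnihilator =
      Submodule.span ℝ (Set.range ![φ 1, φ f]) := by
    apply le_antisymm
    · intro l hl
      rw [Submodule.mem_dualAnnihilator] at hl
      have key := sub_eq_of_tight (g := fun i => l (Pi.single i 1)) (M := l x₀) hT
        (fun i j hadj hij => by
          have := hl _ (vsub_mem_vectorSpan ℝ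
            (single_sub_single_mem_tightSet.2 ⟨hadj, hij⟩) hx₀)
          rw [vsub_eq_sub, map_sub, map_sub] at this
          linarith)
      have : l = (l (Pi.single i₀ 1) - l x₀ * f i₀) • φ 1 + l x₀ • φ f := by
        refine LinearMap.pi_ext' fun i => LinearMap.ext_ring ?_
        have h2 := key i i₀
        simp only [LinearMap.coe_comp, LinearMap.coe_single, Function.comp_apply,
          LinearMap.add_apply, LinearMap.smul_apply, hφ, smul_eq_mul, Pi.one_apply]
        linarith
      rw [this]
      exact add_mem (Submodule.smul_mem _ _ (Submodule.subset_span ⟨0, rfl⟩))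
        (Submodule.smul_mem _ _ (Submodule.subset_span ⟨1, rfl⟩))
    · rw [Submodule.span_le]
      rintro _ ⟨m, rfl⟩
      rw [SetLike.mem_coe, Submodule.mem_dualAnnihilator]
      intro w hw
      refine Submodule.span_induction (p := fun w _ => (![φ 1, φ f] m) w = 0) ?_ (by simp)
        (fun x y _ _ hx hy => by rw [map_add, hx, hy, add_zero])
        (fun a x _ hx => by rw [map_smul, hx, smul_zero]) hw
      rintro _ ⟨_, ⟨i, j, -, hij, rfl⟩, _, ⟨k, l, -, hkl, rfl⟩, rfl⟩
      fin_cases m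
      · simp [hφ]
      · simp only [Fin.mk_one, Matrix.cons_val_one, Matrix.cons_val_fin_one, vsub_eq_sub, map_sub,
          hφ]
        linarith
  have hli : LinearIndependent ℝ ![φ 1, φ f] := by
    rw [LinearIndependent.pair_iff]
    intro s t hst
    have h1 := LinearMap.congr_fun hst (Pi.single i₀ 1)
    have h2 := LinearMap.congr_fun hst (Pi.single j₀ 1)
    simp only [LinearMap.add_apply, LinearMap.smul_apply, hφ, smul_eq_mul, Pi.one_apply,
      LinearMap.zero_apply] at h1 h2
    have ht : t = 0 := by linear_combination h1 - h2 - t * h₀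
    subst ht
    exact ⟨by linarith, rfl⟩
  have hfin := finrank_span_eq_card hli
  have := Subspace.finrank_add_finrank_dualAnnihilator_eq (vectorSpan ℝ (tightSet G f))
  rw [hann, hfin, Module.finrank_fintype_fun_eq_card, Fintype.card_fin] at this
  rw [configDim, hdir, this]

end TightSets

/-! ### Chorded cycles and their step sequences -/

/-- A labelling of the vertices of `G` around a Hamiltonian cycle of length `L`, such that the only
other edge of `G` is the chord joining the vertices labelled `0` and `k`. -/
structure IsChordedCycle {V : Type*} (G : SimpleGraph V) (r : ℕ → V) (k L : ℕ) : Prop where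
  two_le : 2 ≤ k
  add_two_le : k + 2 ≤ L
  inj : ∀ i < L, ∀ j < L, r i = r j → i = j
  surj : ∀ x, ∃ i < L, r i = x
  closed : r L = r 0
  adj : ∀ x y, G.Adj x y ↔ (∃ i < L, s(x, y) = s(r i, r (i + 1))) ∨ s(x, y) = s(r 0, r k)

/-- The step sequence with a zero at `c.1`, value one on `c.2` and minus one elsewhere. -/
def signStep (c : ℕ × Finset ℕ) (j : ℕ) : ℤ :=
  if j = c.1 then 0 else if j ∈ c.2 then 1 else -1

/-- The partial sums of the step sequence. -/
def signHeight (c : ℕ × Finset ℕ) (t : ℕ) : ℤ :=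
  ∑ j ∈ Finset.range t, signStep c j

/-- The step sequences that close up along the cycle and along the chord. -/
def IsBalanced (k L : ℕ) (c : ℕ × Finset ℕ) : Prop :=
  c.1 < L ∧ c.2 ⊆ (Finset.range L).erase c.1 ∧ signHeight c L = 0 ∧ |signHeight c k| ≤ 1

/-- The potential on the vertices given by the partial sums. -/
noncomputable def signPotential {V : Type*} [Nonempty V] (r : ℕ → V) (L : ℕ) (c : ℕ × Finset ℕ)
    (x : V) : ℝ :=
  signHeight c (Function.invFunOn r (Set.Iio L) x)

theorem signStep_cases (c : ℕ × Finset ℕ) (j : ℕ) :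
    signStep c j = 0 ∨ signStep c j = 1 ∨ signStep c j = -1 := by
  unfold signStep
  split_ifs <;> simp

theorem signStep_eq_zero_iff {c : ℕ × Finset ℕ} {j : ℕ} : signStep c j = 0 ↔ j = c.1 := by
  unfold signStep
  split_ifs <;> simp_all

theorem signHeight_succ (c : ℕ × Finset ℕ) (t : ℕ) :
    signHeight c (t + 1) = signHeight c t + signStep c t :=
  Finset.sum_range_succ _ _

theorem SimpleGraph.reachable_of_adj_succ {V : Type*} {T : SimpleGraph V} {r : ℕ → V} {a b : ℕ}
    (hab : a ≤ b) (h : ∀ t, a ≤ t → t < b → T.Adj (r t) (r (t + 1))) :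
    T.Reachable (r a) (r b) := by
  induction b, hab using Nat.le_induction with
  | base => rfl
  | succ n hn ih =>
    exact (ih fun t h1 h2 => h t h1 (by omega)).trans (h n hn (by omega)).reachable

namespace IsChordedCycle

variable {V : Type*} {G : SimpleGraph V} {r : ℕ → V} {k L : ℕ}

theorem eq_or (h : IsChordedCycle G r k L) {i j : ℕ} (hi : i ≤ L) (hj : j ≤ L) (hij : r i = r j) :
    i = j ∨ (i = 0 ∧ j = L) ∨ (i = L ∧ j = 0) := by
  have h1 := h.add_two_le
  have hc := h.closed
  rcases hi.lt_or_eq with hi | rfl <;> rcases hj.lt_or_eq with hj | rfl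
  · exact Or.inl (h.inj i hi j hj hij)
  · have := h.inj i hi 0 (by omega) (hij.trans hc)
    omega
  · have := h.inj 0 (by omega) j hj (hc.symm.trans hij)
    omega
  · exact Or.inl rfl

theorem adj_succ (h : IsChordedCycle G r k L) {t : ℕ} (ht : t < L) : G.Adj (r t) (r (t + 1)) :=
  (h.adj _ _).2 (Or.inl ⟨t, ht, rfl⟩)

theorem adj_chord (h : IsChordedCycle G r k L) : G.Adj (r 0) (r k) :=
  (h.adj _ _).2 (Or.inr rfl)

theorem connected (h : IsChordedCycle G r k L) : G.Connected := by
  rw [SimpleGraph.connected_iff_exists_forall_reachable]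
  refine ⟨r 0, fun x => ?_⟩
  obtain ⟨i, hi, rfl⟩ := h.surj x
  exact SimpleGraph.reachable_of_adj_succ (Nat.zero_le i) fun t _ ht => h.adj_succ (ht.trans hi)

theorem nontrivial (h : IsChordedCycle G r k L) : Nontrivial V :=
  ⟨_, _, h.adj_chord.ne⟩

theorem card_eq [Fintype V] (h : IsChordedCycle G r k L) : Fintype.card V = L := by
  rw [← Finset.card_range L]
  symm
  refine Finset.card_bij (t := Finset.univ) (fun i _ => r i) (by simp) ?_ ?_
  · intro i hi j hj hij
    exact h.inj i (Finset.mem_range.1 hi) j (Finset.mem_range.1 hj) hij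
  · intro x _
    obtain ⟨i, hi, rfl⟩ := h.surj x
    exact ⟨i, Finset.mem_range.2 hi, rfl⟩

section Potential

variable [Nonempty V]

/-- The label `L` repeats the vertex `r 0`; the closing condition makes the two heights agree there.
-/
theorem signPotential_label (h : IsChordedCycle G r k L) {c : ℕ × Finset ℕ}
    (hc : signHeight c L = 0) {t : ℕ} (ht : t ≤ L) :
    signPotential r L c (r t) = signHeight c t := by
  have h2 := h.add_two_le
  have hex : ∃ a ∈ Set.Iio L, r a = r t := h.surj (r t)
  have h3 : Function.invFunOn r (Set.Iio L) (r t) < L := Function.invFunOn_mem hex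
  have h4 := Function.invFunOn_eq hex
  unfold signPotential
  rcases h.eq_or h3.le ht h4 with h5 | ⟨h5, rfl⟩ | ⟨h5, -⟩
  · rw [h5]
  · rw [h5, hc]
    simp [signHeight]
  · omega

theorem signPotential_step (h : IsChordedCycle G r k L) {c : ℕ × Finset ℕ}
    (hc : signHeight c L = 0) {t : ℕ} (ht : t < L) :
    signPotential r L c (r (t + 1)) - signPotential r L c (r t) = signStep c t := by
  rw [h.signPotential_label hc ht.le, h.signPotential_label hc (Nat.succ_le_of_lt ht),
    signHeight_succ]
  push_cast
  ring

theorem signPotential_chord (h : IsChordedCycle G r k L) {c : ℕ × Finset ℕ}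
    (hc : signHeight c L = 0) :
    signPotential r L c (r k) - signPotential r L c (r 0) = signHeight c k := by
  have h2 := h.add_two_le
  rw [h.signPotential_label hc (by omega), h.signPotential_label hc (Nat.zero_le L)]
  simp [signHeight]

theorem isFeasible_signPotential (h : IsChordedCycle G r k L) {c : ℕ × Finset ℕ}
    (hc : IsBalanced k L c) : IsFeasible G (signPotential r L c) := by
  obtain ⟨-, -, hL, hk⟩ := hc
  intro x y hxy
  rcases (h.adj x y).1 hxy with ⟨i, hi, he⟩ | he
  · have h1 := h.signPotential_step hL hi
    have h2 : -1 ≤ signStep c i ∧ signStep c i ≤ 1 := by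
      rcases signStep_cases c i with h' | h' | h' <;> rw [h'] <;> norm_num
    have h3 : (-1 : ℝ) ≤ signStep c i := by exact_mod_cast h2.1
    have h4 : (signStep c i : ℝ) ≤ 1 := by exact_mod_cast h2.2
    rcases Sym2.eq_iff.1 he with ⟨rfl, rfl⟩ | ⟨rfl, rfl⟩ <;> linarith
  · have h1 := h.signPotential_chord hL
    rw [abs_le] at hk
    have h3 : (-1 : ℝ) ≤ signHeight c k := by exact_mod_cast hk.1
    have h4 : (signHeight c k : ℝ) ≤ 1 := by exact_mod_cast hk.2
    rcases Sym2.eq_iff.1 he with ⟨rfl, rfl⟩ | ⟨rfl, rfl⟩ <;> linarith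

/-- Only the cycle edge `c.1` is flat, and removing one edge from the Hamiltonian cycle leaves a
spanning path of tight edges. -/
theorem connected_tightGraph_signPotential (h : IsChordedCycle G r k L) {c : ℕ × Finset ℕ}
    (hc : IsBalanced k L c) : (tightGraph G (signPotential r L c)).Connected := by
  obtain ⟨-, -, hL, -⟩ := hc
  have hadj : ∀ t < L, t ≠ c.1 → (tightGraph G (signPotential r L c)).Adj (r t) (r (t + 1)) := by
    intro t ht htc
    refine ⟨h.adj_succ ht, ?_⟩
    have h1 := h.signPotential_step hL ht
    rcases signStep_cases c t with h' | h' | h'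
    · exact absurd (signStep_eq_zero_iff.1 h') htc
    · right; rw [h1, h']; norm_num
    · left; rw [h'] at h1; push_cast at h1; linarith
  rw [SimpleGraph.connected_iff_exists_forall_reachable]
  refine ⟨r 0, fun x => ?_⟩
  obtain ⟨i, hi, rfl⟩ := h.surj x
  by_cases hic : i ≤ c.1
  · exact SimpleGraph.reachable_of_adj_succ (Nat.zero_le i) fun t _ ht =>
      hadj t (by omega) (by omega)
  · rw [← h.closed]
    exact (SimpleGraph.reachable_of_adj_succ hi.le fun t ht1 ht2 =>
      hadj t (by omega) (by omega)).symm

end Potential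

/-- Two flat edges of the cycle can only occur on different sides of the chord. -/
theorem separated_of_flat (h : IsChordedCycle G r k L) {f : V → ℝ}
    (hT : (tightGraph G f).Connected) {i j : ℕ} (hij : i < j) (hj : j < L)
    (hfi : f (r i) = f (r (i + 1))) (hfj : f (r j) = f (r (j + 1))) : i < k ∧ k ≤ j := by
  by_contra hk
  have h1 := h.add_two_le
  -- If the flat edges are not separated, the arc of labels `i + 1, …, j` contains neither end of
  -- the chord. Both cycle edges leaving it are flat, so tight edges never leave it and `r 0` is
  -- unreachable.
  have hstep : ∀ x y, (tightGraph G f).Adj x y → (∃ t, i < t ∧ t ≤ j ∧ r t = x) →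
      ∃ t, i < t ∧ t ≤ j ∧ r t = y := by
    rintro x y ⟨hxy, hf⟩ ⟨t, hit, htj, rfl⟩
    rcases (h.adj _ y).1 hxy with ⟨e, he, hs⟩ | hs
    · have hei : e ≠ i := by
        rintro rfl
        rcases Sym2.eq_iff.1 hs with ⟨h2, h3⟩ | ⟨h2, h3⟩ <;> rw [h2, h3, hfi] at hf <;> norm_num at hf
      have hej : e ≠ j := by
        rintro rfl
        rcases Sym2.eq_iff.1 hs with ⟨h2, h3⟩ | ⟨h2, h3⟩ <;> rw [h2, h3, hfj] at hf <;> norm_num at hf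
      rcases Sym2.eq_iff.1 hs with ⟨h2, rfl⟩ | ⟨h2, rfl⟩
      · have := h.eq_or (by omega) he.le h2
        exact ⟨e + 1, by omega, by omega, rfl⟩
      · have := h.eq_or (by omega) (Nat.succ_le_of_lt he) h2
        exact ⟨e, by omega, by omega, rfl⟩
    · rcases Sym2.eq_iff.1 hs with ⟨h2, rfl⟩ | ⟨h2, rfl⟩
      · have := h.eq_or (by omega) (Nat.zero_le L) h2
        omega
      · have := h.eq_or (by omega) (by omega) h2
        omega
  have hreach : ∀ x y, (tightGraph G f).Reachable x y → (∃ t, i < t ∧ t ≤ j ∧ r t = x) →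
      ∃ t, i < t ∧ t ≤ j ∧ r t = y := by
    rintro x y ⟨w⟩
    induction w with
    | nil => exact id
    | cons hadj _ ih => exact fun hx => ih (hstep _ _ hadj hx)
  obtain ⟨t, hit, htj, ht⟩ := hreach _ _ (hT.preconnected (r (i + 1)) (r 0))
    ⟨i + 1, by omega, by omega, rfl⟩
  have := h.eq_or (by omega) (Nat.zero_le L) ht
  omega

end IsChordedCycle

/-! ### Facets of a chorded odd cycle correspond to balanced sequences -/

theorem exists_int_of_connected_tightGraph {V : Type*} {G : SimpleGraph V} {f : V → ℝ}
    (hT : (tightGraph G f).Connected) (x y : V) : ∃ n : ℤ, f y - f x = n := by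
  obtain ⟨w⟩ := hT.preconnected x y
  induction w with
  | nil => exact ⟨0, by simp⟩
  | cons hadj _ ih =>
    obtain ⟨n, hn⟩ := ih
    rcases hadj.2 with h | h
    · exact ⟨n - 1, by push_cast; linarith⟩
    · exact ⟨n + 1, by push_cast; linarith⟩

theorem tightSet_congr {V : Type*} [DecidableEq V] {G : SimpleGraph V} {f g : V → ℝ}
    (h : ∀ x y, f x - f y = g x - g y) : tightSet G f = tightSet G g := by
  simp only [tightSet, h]

namespace IsChordedCycle

variable {V : Type*} {G : SimpleGraph V} {r : ℕ → V} {k L : ℕ}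

/-- Parity makes the number of flat cycle edges odd and the chord bounds it by two, so it is one;
the remaining steps are signs. -/
theorem exists_isBalanced [Nonempty V] [DecidableEq V] (h : IsChordedCycle G r k L) (hL : Odd L)
    {f : V → ℝ} (hf : IsFeasible G f) (hT : (tightGraph G f).Connected) :
    ∃ c, IsBalanced k L c ∧ tightSet G f = tightSet G (signPotential r L c) := by
  have h1 := h.add_two_le
  choose z hz using exists_int_of_connected_tightGraph hT (r 0)
  have hz0 : z (r 0) = 0 := by
    have := hz (r 0)
    rw [sub_self] at this
    exact_mod_cast this.symm
  have hadj : ∀ x y, G.Adj x y → -1 ≤ z y - z x ∧ z y - z x ≤ 1 := by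
    intro x y hxy
    have h2 := hf x y hxy
    have h3 := hf y x hxy.symm
    have h4 := hz x
    have h5 := hz y
    constructor
    · have : (-1 : ℝ) ≤ z y - z x := by linarith
      exact_mod_cast this
    · have : (z y - z x : ℝ) ≤ 1 := by linarith
      exact_mod_cast this
  set d : ℕ → ℤ := fun t => z (r (t + 1)) - z (r t) with hd
  have hdb : ∀ t < L, -1 ≤ d t ∧ d t ≤ 1 := fun t ht => hadj _ _ (h.adj_succ ht)
  have hsum : ∀ t, ∑ j ∈ Finset.range t, d j = z (r t) := by
    intro t
    rw [hd, Finset.sum_range_sub (fun i => z (r i)), hz0, sub_zero]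
  set Z := (Finset.range L).filter fun t => d t = 0 with hZ
  have hflat : ∀ t ∈ Z, t < L ∧ f (r t) = f (r (t + 1)) := by
    intro t ht
    rw [hZ, Finset.mem_filter, Finset.mem_range] at ht
    refine ⟨ht.1, ?_⟩
    have h2 := hz (r t)
    have h3 := hz (r (t + 1))
    have h4 : z (r (t + 1)) = z (r t) := sub_eq_zero.1 ht.2
    rw [h4] at h3
    linarith
  have hodd : Odd Z.card := by
    have h2 : Z.card + ((Finset.range L).filter fun t => ¬ d t = 0).card = L := by
      rw [hZ, Finset.card_filter_add_card_filter_not, Finset.card_range]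
    -- Each step is congruent mod 2 to the indicator of being nonzero. The steps sum to 0, so the
    -- number of nonzero ones is even.
    have h3 : (2 : ℤ) ∣ ∑ t ∈ Finset.range L, (d t - if ¬ d t = 0 then 1 else 0) := by
      refine Finset.dvd_sum fun t ht => ?_
      have := hdb t (Finset.mem_range.1 ht)
      split_ifs with h0 <;> omega
    rw [Finset.sum_sub_distrib, hsum, h.closed, hz0, Finset.sum_boole] at h3
    rw [← h2] at hL
    rw [Nat.odd_iff] at hL ⊢
    omega
  have hsep : ∀ i ∈ Z, ∀ j ∈ Z, i ≠ j → (i < k ∧ k ≤ j) ∨ (j < k ∧ k ≤ i) := by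
    intro i hi j hj hij
    rcases lt_or_gt_of_ne hij with h2 | h2
    · exact Or.inl (h.separated_of_flat hT h2 (hflat j hj).1 (hflat i hi).2 (hflat j hj).2)
    · exact Or.inr (h.separated_of_flat hT h2 (hflat i hi).1 (hflat j hj).2 (hflat i hi).2)
  -- Among three indices, two lie on the same side of `k`.
  have hle : Z.card ≤ 2 := by
    by_contra hgt
    obtain ⟨a, ha, b, hb, c, hc, hab, hac, hbc⟩ := Finset.two_lt_card.1 (not_le.1 hgt)
    have h2 := hsep a ha b hb hab
    have h3 := hsep a ha c hc hac
    have h4 := hsep b hb c hc hbc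
    omega
  have hone : Z.card = 1 := by
    rw [Nat.odd_iff] at hodd
    omega
  obtain ⟨i₀, hi₀⟩ := Finset.card_eq_one.1 hone
  have hmemZ : ∀ t < L, d t = 0 ↔ t = i₀ := by
    intro t ht
    rw [← Finset.mem_singleton (b := t), ← hi₀, hZ, Finset.mem_filter, Finset.mem_range]
    simp [ht]
  have hi₀L : i₀ < L := (hflat i₀ (by rw [hi₀]; exact Finset.mem_singleton_self _)).1
  set c : ℕ × Finset ℕ := (i₀, (Finset.range L).filter fun t => d t = 1) with hc
  have hstep : ∀ t < L, signStep c t = d t := by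
    intro t ht
    have h2 := hmemZ t ht
    have h3 := hdb t ht
    simp only [signStep, hc, Finset.mem_filter, Finset.mem_range, ht, true_and]
    split_ifs with h4 h5
    · exact (h2.2 h4).symm
    · exact h5.symm
    · have : d t ≠ 0 := fun h0 => h4 (h2.1 h0)
      omega
  have hheight : ∀ t ≤ L, signHeight c t = z (r t) := by
    intro t ht
    rw [← hsum, signHeight]
    exact Finset.sum_congr rfl fun j hj =>
      hstep j ((Finset.mem_range.1 hj).trans_le ht)
  have hbal : IsBalanced k L c := by
    refine ⟨hi₀L, ?_, ?_, ?_⟩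
    · intro t ht
      rw [hc, Finset.mem_filter] at ht
      rw [Finset.mem_erase]
      refine ⟨?_, ht.1⟩
      intro h2
      have := (hmemZ t (Finset.mem_range.1 ht.1)).2 h2
      omega
    · rw [hheight L le_rfl, h.closed, hz0]
    · rw [hheight k (by omega), abs_le]
      have := hadj _ _ h.adj_chord
      rwa [hz0, sub_zero] at this
  refine ⟨c, hbal, tightSet_congr fun x y => ?_⟩
  obtain ⟨i, hi, rfl⟩ := h.surj x
  obtain ⟨j, hj, rfl⟩ := h.surj y
  rw [h.signPotential_label hbal.2.2.1 hi.le, h.signPotential_label hbal.2.2.1 hj.le,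
    hheight i hi.le, hheight j hj.le, ← hz, ← hz]
  ring

variable [DecidableEq V]

/-- Which orientation of a cycle edge lies in the tight set, if any, reveals the step on that edge.
-/
theorem injOn_tightSet_signPotential [Nonempty V] (h : IsChordedCycle G r k L) :
    Set.InjOn (fun c => tightSet G (signPotential r L c)) {c | IsBalanced k L c} := by
  have key : ∀ c, IsBalanced k L c → ∀ t < L,
      ((Pi.single (r (t + 1)) 1 - Pi.single (r t) 1 : V → ℝ) ∈ tightSet G (signPotential r L c) ↔
        signStep c t = 1) ∧
      ((Pi.single (r t) 1 - Pi.single (r (t + 1)) 1 : V → ℝ) ∈ tightSet G (signPotential r L c) ↔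
        signStep c t = -1) := by
    intro c hc t ht
    have hadj := h.adj_succ ht
    have h1 := h.signPotential_step hc.2.2.1 ht
    rw [single_sub_single_mem_tightSet, single_sub_single_mem_tightSet, h1,
      ← neg_sub (signPotential r L c (r (t + 1))), h1, neg_eq_iff_eq_neg]
    refine ⟨⟨fun h2 => by exact_mod_cast h2.2, fun h2 => ⟨hadj.symm, by exact_mod_cast h2⟩⟩,
      ⟨fun h2 => by exact_mod_cast h2.2, fun h2 => ⟨hadj, by exact_mod_cast h2⟩⟩⟩
  intro c hc c' hc' heq
  simp only at heq
  have hstep : ∀ t < L, signStep c t = signStep c' t := by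
    intro t ht
    have h1 := key c hc t ht
    have h2 := key c' hc' t ht
    rw [heq] at h1
    have h3 := h1.1.symm.trans h2.1
    have h4 := h1.2.symm.trans h2.2
    have h5 := signStep_cases c t
    have h6 := signStep_cases c' t
    omega
  have hfst : c.1 = c'.1 :=
    signStep_eq_zero_iff.1 ((hstep c.1 hc.1).symm.trans (signStep_eq_zero_iff.2 rfl))
  refine Prod.ext hfst (Finset.ext fun t => ?_)
  have hmem : ∀ c, IsBalanced k L c → (t ∈ c.2 ↔ t < L ∧ signStep c t = 1) := by
    intro c hc
    constructor
    · intro ht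
      have := Finset.mem_erase.1 (hc.2.1 ht)
      exact ⟨Finset.mem_range.1 this.2, by simp [signStep, this.1, ht]⟩
    · rintro ⟨-, ht⟩
      unfold signStep at ht
      split_ifs at ht with h1 h2
      · omega
      · exact h2
  rw [hmem c hc, hmem c' hc']
  exact and_congr_right fun ht => by rw [hstep t ht]

/-- The number of points of the configuration on the hyperplane given by a potential. -/
theorem ncard_tightSet (h : IsChordedCycle G r k L) (f : V → ℝ) :
    (tightSet G f).ncard =
      ({i ∈ Finset.range L | |f (r (i + 1)) - f (r i)| = 1}).card +
        if |f (r k) - f (r 0)| = 1 then 1 else 0 := by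
  classical
  have h1 := h.add_two_le
  have h0 := h.two_le
  -- The index `L` stands for the chord, so that `0, …, L` enumerates every edge exactly once.
  let a : ℕ → V := fun i => if i < L then r i else r 0
  let b : ℕ → V := fun i => if i < L then r (i + 1) else r k
  have ha : ∀ i < L, a i = r i := fun i hi => if_pos hi
  have hb : ∀ i < L, b i = r (i + 1) := fun i hi => if_pos hi
  have haL : a L = r 0 := if_neg (lt_irrefl L)
  have hbL : b L = r k := if_neg (lt_irrefl L)
  have hab : ∀ x y, G.Adj x y ↔ ∃ i < L + 1, s(x, y) = s(a i, b i) := by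
    intro x y
    rw [h.adj]
    constructor
    · rintro (⟨i, hi, he⟩ | he)
      · exact ⟨i, by omega, by rw [ha i hi, hb i hi, he]⟩
      · exact ⟨L, by omega, by rw [haL, hbL, he]⟩
    · rintro ⟨i, hi, he⟩
      rcases (Nat.lt_succ_iff.1 hi).lt_or_eq with hi | rfl
      · exact Or.inl ⟨i, hi, by rw [← ha i hi, ← hb i hi, he]⟩
      · exact Or.inr (by rw [he, haL, hbL])
  have hinj : ∀ i < L + 1, ∀ j < L + 1, s(a i, b i) = s(a j, b j) → i = j := by
    intro i hi j hj he
    rcases (Nat.lt_succ_iff.1 hi).lt_or_eq with hi | rfl <;>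
      rcases (Nat.lt_succ_iff.1 hj).lt_or_eq with hj | rfl
    · rw [ha i hi, hb i hi, ha j hj, hb j hj] at he
      rcases Sym2.eq_iff.1 he with ⟨h2, h3⟩ | ⟨h2, h3⟩
      · exact h.inj i hi j hj h2
      · have h4 := h.eq_or hi.le (Nat.succ_le_of_lt hj) h2
        have h5 := h.eq_or (Nat.succ_le_of_lt hi) hj.le h3
        omega
    · rw [ha i hi, hb i hi, haL, hbL] at he
      rcases Sym2.eq_iff.1 he with ⟨h2, h3⟩ | ⟨h2, h3⟩
      · have h4 := h.eq_or hi.le (Nat.zero_le _) h2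
        have h5 := h.eq_or (Nat.succ_le_of_lt hi) (by omega) h3
        omega
      · have h4 := h.eq_or hi.le (by omega) h2
        have h5 := h.eq_or (Nat.succ_le_of_lt hi) (by omega) h3
        omega
    · rw [haL, hbL, ha j hj, hb j hj] at he
      rcases Sym2.eq_iff.1 he with ⟨h2, h3⟩ | ⟨h2, h3⟩
      · have h4 := h.eq_or (by omega) hj.le h2
        have h5 := h.eq_or (by omega) (Nat.succ_le_of_lt hj) h3
        omega
      · have h4 := h.eq_or (by omega) (Nat.succ_le_of_lt hj) h2
        have h5 := h.eq_or (by omega) hj.le h3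
        omega
    · rfl
  have himage : tightSet G f = (fun i => if f (b i) - f (a i) = 1
      then (Pi.single (b i) 1 - Pi.single (a i) 1 : V → ℝ) else Pi.single (a i) 1 - Pi.single (b i) 1)
        '' ({i ∈ Finset.range (L + 1) | |f (b i) - f (a i)| = 1} : Finset ℕ) := by
    ext x
    simp only [Set.mem_image, Finset.coe_filter, Set.mem_ofPred_eq, Finset.mem_range]
    constructor
    · rintro ⟨p, q, hpq, hf, rfl⟩
      obtain ⟨i, hi, he⟩ := (hab p q).1 hpq
      refine ⟨i, ⟨hi, ?_⟩, ?_⟩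
      · rcases Sym2.eq_iff.1 he with ⟨rfl, rfl⟩ | ⟨rfl, rfl⟩
        · rw [abs_sub_comm, hf, abs_one]
        · rw [hf, abs_one]
      · rcases Sym2.eq_iff.1 he with ⟨rfl, rfl⟩ | ⟨rfl, rfl⟩
        · rw [if_neg]
          linarith
        · rw [if_pos hf]
    · rintro ⟨i, ⟨hi, hf⟩, rfl⟩
      have hadj : G.Adj (a i) (b i) := (hab _ _).2 ⟨i, hi, rfl⟩
      split_ifs with h2
      · exact ⟨_, _, hadj.symm, h2, rfl⟩
      · refine ⟨_, _, hadj, ?_, rfl⟩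
        rcases (abs_eq zero_le_one).1 hf with h3 | h3
        · exact absurd h3 h2
        · linarith
  rw [himage, Set.InjOn.ncard_image, Set.ncard_coe_finset, Finset.range_add_one,
    Finset.filter_insert, haL, hbL]
  · have hfil : {i ∈ Finset.range L | |f (b i) - f (a i)| = 1} =
        {i ∈ Finset.range L | |f (r (i + 1)) - f (r i)| = 1} :=
      Finset.filter_congr fun i hi => by
        rw [ha i (Finset.mem_range.1 hi), hb i (Finset.mem_range.1 hi)]
    rw [hfil]
    split_ifs
    · rw [Finset.card_insert_of_notMem (by simp)]
    · rfl
  · intro i hi j hj he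
    simp only [Finset.coe_filter, Set.mem_ofPred_eq, Finset.mem_range] at hi hj
    have hi' : G.Adj (a i) (b i) := (hab _ _).2 ⟨i, hi.1, rfl⟩
    refine hinj i hi.1 j hj.1 (Sym2.eq_iff.2 ?_)
    simp only at he
    split_ifs at he
    · have := single_sub_single_inj hi'.ne' he
      exact Or.inl ⟨this.2, this.1⟩
    · have := single_sub_single_inj hi'.ne' he
      exact Or.inr ⟨this.2, this.1⟩
    · have := single_sub_single_inj hi'.ne he
      exact Or.inr this
    · have := single_sub_single_inj hi'.ne he
      exact Or.inl this

/-- The `L - 1` tight cycle edges exactly balance dimension `L - 2` plus one; the corank is what the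
chord contributes. -/
theorem configCorank_tightSet [Fintype V] [Nonempty V] (h : IsChordedCycle G r k L)
    {c : ℕ × Finset ℕ} (hc : IsBalanced k L c) :
    configCorank (tightSet G (signPotential r L c)) = |signHeight c k| := by
  have := h.nontrivial
  have h1 := h.add_two_le
  have hdim := configDim_tightSet (h.connected_tightGraph_signPotential hc)
  rw [h.card_eq] at hdim
  have hfil : {i ∈ Finset.range L |
      |signPotential r L c (r (i + 1)) - signPotential r L c (r i)| = 1} =
      (Finset.range L).erase c.1 := by
    ext t
    rw [Finset.mem_filter, Finset.mem_erase, Finset.mem_range, and_comm]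
    refine and_congr_left fun ht => ?_
    rw [h.signPotential_step hc.2.2.1 ht, ne_eq, ← signStep_eq_zero_iff]
    rcases signStep_cases c t with h' | h' | h' <;> simp [h']
  have hcard := h.ncard_tightSet (signPotential r L c)
  rw [hfil, Finset.card_erase_of_mem (Finset.mem_range.2 hc.1), Finset.card_range,
    h.signPotential_chord hc.2.2.1] at hcard
  have hk := hc.2.2.2
  have hk0 := abs_nonneg (signHeight c k)
  have hcases : |signHeight c k| = 0 ∨ |signHeight c k| = 1 := by omega
  unfold configCorank
  rcases hcases with h2 | h2
  · have h3 : |(signHeight c k : ℝ)| = 0 := by exact_mod_cast h2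
    rw [h3] at hcard
    simp at hcard
    omega
  · have h3 : |(signHeight c k : ℝ)| = 1 := by exact_mod_cast h2
    rw [h3] at hcard
    simp at hcard
    omega

theorem configFacets_eq_image [Fintype V] [Nonempty V] (h : IsChordedCycle G r k L) (hL : Odd L) :
    configFacets (adjacencyConfig G) =
      (fun c => tightSet G (signPotential r L c)) '' {c | IsBalanced k L c} := by
  have := h.nontrivial
  ext F
  rw [mem_configFacets_adjacencyConfig_iff h.connected]
  constructor
  · rintro ⟨f, hf, hT, rfl⟩
    obtain ⟨c, hc, he⟩ := h.exists_isBalanced hL hf hT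
    exact ⟨c, hc, he.symm⟩
  · rintro ⟨c, hc, rfl⟩
    exact ⟨_, h.isFeasible_signPotential hc, h.connected_tightGraph_signPotential hc, rfl⟩

theorem ncard_configFacets [Fintype V] [Nonempty V] (h : IsChordedCycle G r k L) (hL : Odd L) :
    (configFacets (adjacencyConfig G)).ncard = {c | IsBalanced k L c}.ncard := by
  rw [h.configFacets_eq_image hL, h.injOn_tightSet_signPotential.ncard_image]

theorem ncard_configFacets_corank [Fintype V] [Nonempty V] (h : IsChordedCycle G r k L)
    (hL : Odd L) (q : ℤ) :
    {F ∈ configFacets (adjacencyConfig G) | configCorank F = q}.ncard =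
      {c | IsBalanced k L c ∧ |signHeight c k| = q}.ncard := by
  have : {F ∈ configFacets (adjacencyConfig G) | configCorank F = q} =
      (fun c => tightSet G (signPotential r L c)) ''
        {c | IsBalanced k L c ∧ |signHeight c k| = q} := by
    rw [h.configFacets_eq_image hL]
    ext F
    constructor
    · rintro ⟨⟨c, hc, rfl⟩, hq⟩
      exact ⟨c, ⟨hc, by rw [← h.configCorank_tightSet hc]; exact hq⟩, rfl⟩
    · rintro ⟨c, ⟨hc, hq⟩, rfl⟩
      exact ⟨⟨c, hc, rfl⟩, (h.configCorank_tightSet hc).trans hq⟩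
  rw [this, (h.injOn_tightSet_signPotential.mono fun c hc => hc.1).ncard_image]

end IsChordedCycle

/-! ### From two cycles sharing an edge to a chorded cycle -/

/-- A rotation or a reflection, according to orientation, carries the closing edge from 0 to `-1`
onto any given edge. -/
theorem SimpleGraph.cycleGraph_exists_iso {n : ℕ} {a b : Fin (n + 2)}
    (h : (cycleGraph (n + 2)).Adj a b) :
    ∃ e : cycleGraph (n + 2) ≃g cycleGraph (n + 2), e 0 = a ∧ e (Fin.last (n + 1)) = b := by
  have hlast : Fin.last (n + 1) = -1 := by
    rw [eq_neg_iff_add_eq_zero, Fin.last_add_one]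
  rcases cycleGraph_adj.1 h with h' | h'
  · refine ⟨⟨Equiv.addLeft a, ?_⟩, ?_, ?_⟩
    · intro x y
      simp [cycleGraph_adj]
    · simp
    · have : b = a - 1 := by rw [← h']; abel
      simp [hlast, this, sub_eq_add_neg]
  · refine ⟨⟨Equiv.subLeft a, ?_⟩, ?_, ?_⟩
    · intro x y
      simp [cycleGraph_adj, or_comm]
    · simp
    · have : b = a + 1 := by rw [← h']; abel
      simp [hlast, this]

theorem SimpleGraph.cycleGraph_adj_iff_val {n : ℕ} {i j : Fin (n + 2)} :
    (cycleGraph (n + 2)).Adj i j ↔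
      (i.val + 1 = j.val ∨ j.val + 1 = i.val) ∨
        (i.val = 0 ∧ j.val = n + 1) ∨ (i.val = n + 1 ∧ j.val = 0) := by
  have key : ∀ i j : Fin (n + 2), i - j = 1 ↔ j.val + 1 = i.val ∨ (i.val = 0 ∧ j.val = n + 1) := by
    intro i j
    rw [sub_eq_iff_eq_add', Fin.ext_iff, Fin.val_add_one]
    have := Fin.val_last (n + 1)
    split_ifs with h
    · rw [h]
      omega
    · have : j.val ≠ n + 1 := fun h' => h (Fin.ext h')
      omega
  rw [cycleGraph_adj, key, key]
  omega

/-- A cycle subgraph can be traversed starting at one end of a given edge and ending at the other. -/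
theorem SimpleGraph.Subgraph.exists_cycle_labelling {V : Type*} {G : SimpleGraph V}
    {C : G.Subgraph} {n : ℕ} (φ : C.coe ≃g cycleGraph (n + 2)) {u v : V} (h : C.Adj u v) :
    ∃ p : ℕ → V, p 0 = u ∧ p (n + 1) = v ∧ (∀ i < n + 2, ∀ j < n + 2, p i = p j → i = j) ∧
      (∀ x, x ∈ C.verts ↔ ∃ i < n + 2, p i = x) ∧
      ∀ x y, C.Adj x y ↔ (∃ i < n + 1, s(x, y) = s(p i, p (i + 1))) ∨ s(x, y) = s(u, v) := by
  have hab : (cycleGraph (n + 2)).Adj (φ ⟨u, h.fst_mem⟩) (φ ⟨v, h.snd_mem⟩) :=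
    φ.map_adj_iff.2 h
  obtain ⟨e, he0, he1⟩ := cycleGraph_exists_iso hab
  let ψ : cycleGraph (n + 2) ≃g C.coe := e.trans φ.symm
  have hψ0 : (ψ 0 : V) = u := by simp [ψ, he0]
  have hψ1 : (ψ (Fin.last (n + 1)) : V) = v := by simp [ψ, he1]
  have hsurj : ∀ x (hx : x ∈ C.verts), ∃ i, (ψ i : V) = x := fun x hx => by
    obtain ⟨i, hi⟩ := ψ.surjective ⟨x, hx⟩
    exact ⟨i, by rw [hi]⟩
  have hcast : ∀ i : Fin (n + 2), Fin.ofNat (n + 2) i.val = i := fun i =>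
    Fin.ext (Nat.mod_eq_of_lt i.2)
  have hval : ∀ i < n + 2, (Fin.ofNat (n + 2) i).val = i := fun i hi => Nat.mod_eq_of_lt hi
  have hp0 : (ψ (Fin.ofNat (n + 2) 0) : V) = u := by
    rw [← hψ0]; rfl
  have hp1 : (ψ (Fin.ofNat (n + 2) (n + 1)) : V) = v := by
    rw [← hψ1, ← hcast (Fin.last (n + 1))]; rfl
  have hadj : ∀ i < n + 2, ∀ j < n + 2,
      (C.Adj (ψ (Fin.ofNat (n + 2) i)) (ψ (Fin.ofNat (n + 2) j)) ↔
      (i + 1 = j ∨ j + 1 = i) ∨ (i = 0 ∧ j = n + 1) ∨ (i = n + 1 ∧ j = 0)) := by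
    intro i hi j hj
    have h1 : C.coe.Adj (ψ (Fin.ofNat (n + 2) i)) (ψ (Fin.ofNat (n + 2) j)) ↔ _ :=
      ψ.map_adj_iff.trans cycleGraph_adj_iff_val
    rwa [hval i hi, hval j hj] at h1
  have hmem : ∀ x, x ∈ C.verts ↔ ∃ i < n + 2, (ψ (Fin.ofNat (n + 2) i) : V) = x := by
    intro x
    constructor
    · intro hx
      obtain ⟨i, rfl⟩ := hsurj x hx
      exact ⟨i, i.2, by rw [hcast]⟩
    · rintro ⟨i, -, rfl⟩
      exact (ψ _).2
  refine ⟨fun i => ψ (Fin.ofNat (n + 2) i), hp0, hp1, ?_, hmem, ?_⟩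
  · intro i hi j hj hij
    have := congrArg Fin.val (ψ.injective (Subtype.ext hij))
    rwa [hval i hi, hval j hj] at this
  · intro x y
    constructor
    · intro hxy
      obtain ⟨i, hi, rfl⟩ := (hmem x).1 hxy.fst_mem
      obtain ⟨j, hj, rfl⟩ := (hmem y).1 hxy.snd_mem
      rcases (hadj i hi j hj).1 hxy with (rfl | rfl) | ⟨rfl, rfl⟩ | ⟨rfl, rfl⟩
      · exact Or.inl ⟨i, by omega, rfl⟩
      · exact Or.inl ⟨j, by omega, Sym2.eq_swap⟩
      · exact Or.inr (by rw [hp0, hp1])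
      · exact Or.inr (by rw [hp0, hp1, Sym2.eq_swap])
    · rintro (⟨i, hi, he⟩ | he)
      · have h1 := (hadj i (by omega) (i + 1) (by omega)).2 (Or.inl (Or.inl rfl))
        rcases Sym2.eq_iff.1 he with ⟨rfl, rfl⟩ | ⟨rfl, rfl⟩
        · exact h1
        · exact h1.symm
      · rcases Sym2.eq_iff.1 he with ⟨rfl, rfl⟩ | ⟨rfl, rfl⟩
        · exact h
        · exact h.symm

theorem IsCycleEdgeJoin.exists_isChordedCycle {V : Type*} {G : SimpleGraph V} {a b : ℕ}
    (hG : IsCycleEdgeJoin G (a + 3) (b + 3)) :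
    ∃ r, IsChordedCycle G r (a + 2) (a + 2 + (b + 2)) := by
  obtain ⟨C₁, C₂, ⟨φ₁⟩, ⟨φ₂⟩, hsup, u, v, huv, hinf⟩ := hG
  have hinfadj : (C₁ ⊓ C₂).Adj u v := by rw [hinf]; simp
  have hinfv : ∀ x, x ∈ C₁.verts → x ∈ C₂.verts → x = u ∨ x = v := by
    intro x h1 h2
    have : x ∈ (C₁ ⊓ C₂).verts := ⟨h1, h2⟩
    rw [hinf] at this
    simpa using this
  have hGadj : ∀ x y, G.Adj x y ↔ C₁.Adj x y ∨ C₂.Adj x y := by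
    intro x y
    rw [← SimpleGraph.Subgraph.sup_adj, hsup, SimpleGraph.Subgraph.top_adj]
  have hGv : ∀ x, x ∈ C₁.verts ∨ x ∈ C₂.verts := by
    intro x
    have : x ∈ (C₁ ⊔ C₂).verts := by rw [hsup]; trivial
    exact this
  obtain ⟨p, hp0, hp1, hpinj, hpv, hpadj⟩ :=
    SimpleGraph.Subgraph.exists_cycle_labelling (n := a + 1) φ₁ hinfadj.1
  obtain ⟨q, hq0, hq1, hqinj, hqv, hqadj⟩ :=
    SimpleGraph.Subgraph.exists_cycle_labelling (n := b + 1) φ₂ hinfadj.2.symm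
  -- Follow the first cycle from `u` to `v` the long way, then the second from `v` back to `u`; the
  -- shared edge becomes the chord.
  let r : ℕ → V := fun i => if i ≤ a + 2 then p i else q (i - (a + 2))
  have hrp : ∀ i ≤ a + 2, r i = p i := fun i hi => if_pos hi
  have hrq : ∀ i, r (a + 2 + i) = q i := by
    intro i
    rcases Nat.eq_zero_or_pos i with rfl | hi
    · rw [hrp _ le_rfl, hq0, ← hp1]
    · have : ¬ (a + 2 + i ≤ a + 2) := by omega
      simp only [r, if_neg this, Nat.add_sub_cancel_left]
  have hr0 : r 0 = u := by rw [hrp 0 (by omega), hp0]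
  have hrk : r (a + 2) = v := by rw [hrp _ le_rfl, ← hp1]
  have hdisj : ∀ i ≤ a + 2, ∀ j, 0 < j → j < b + 2 → p i ≠ q j := by
    intro i hi j hj hj' he
    have h1 : p i ∈ C₁.verts := (hpv _).2 ⟨i, by omega, rfl⟩
    have h2 : p i ∈ C₂.verts := (hqv _).2 ⟨j, by omega, he.symm⟩
    rcases hinfv _ h1 h2 with h3 | h3
    · have := hqinj j (by omega) (b + 1 + 1) (by omega) (by rw [← he, h3, hq1])
      omega
    · have := hqinj j (by omega) 0 (by omega) (by rw [← he, h3, hq0])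
      omega
  refine ⟨r, by omega, by omega, ?_, ?_, ?_, ?_⟩
  · intro i hi j hj hij
    rcases le_or_gt i (a + 2) with hi' | hi' <;> rcases le_or_gt j (a + 2) with hj' | hj'
    · rw [hrp i hi', hrp j hj'] at hij
      exact hpinj i (by omega) j (by omega) hij
    · obtain ⟨j, rfl⟩ := Nat.exists_eq_add_of_lt hj'
      rw [hrp i hi', add_assoc, hrq] at hij
      exact absurd hij (hdisj i hi' _ (by omega) (by omega))
    · obtain ⟨i, rfl⟩ := Nat.exists_eq_add_of_lt hi'
      rw [hrp j hj', add_assoc, hrq] at hij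
      exact absurd hij.symm (hdisj j hj' _ (by omega) (by omega))
    · obtain ⟨i, rfl⟩ := Nat.exists_eq_add_of_lt hi'
      obtain ⟨j, rfl⟩ := Nat.exists_eq_add_of_lt hj'
      rw [add_assoc, hrq, add_assoc, hrq] at hij
      have := hqinj _ (by omega) _ (by omega) hij
      omega
  · intro x
    rcases hGv x with hx | hx
    · obtain ⟨i, hi, rfl⟩ := (hpv x).1 hx
      exact ⟨i, by omega, hrp i (by omega)⟩
    · obtain ⟨i, hi, rfl⟩ := (hqv x).1 hx
      rcases (Nat.lt_succ_iff.1 hi).lt_or_eq with hi' | rfl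
      · exact ⟨a + 2 + i, by omega, hrq i⟩
      · exact ⟨0, by omega, by rw [hr0, hq1]⟩
  · rw [hrq, hr0, ← hq1]
  · intro x y
    rw [hGadj, hpadj, hqadj, hr0, hrk, Sym2.eq_swap (a := v)]
    constructor
    · rintro ((⟨i, hi, he⟩ | he) | (⟨i, hi, he⟩ | he))
      · exact Or.inl ⟨i, by omega, by rw [he, hrp i (by omega), hrp (i + 1) (by omega)]⟩
      · exact Or.inr he
      · exact Or.inl ⟨a + 2 + i, by omega, by rw [he, hrq, add_assoc, hrq]⟩
      · exact Or.inr he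
    · rintro (⟨i, hi, he⟩ | he)
      · rcases lt_or_ge i (a + 2) with hi' | hi'
        · exact Or.inl (Or.inl ⟨i, by omega, by rw [he, hrp i (by omega), hrp (i + 1) (by omega)]⟩)
        · obtain ⟨i, rfl⟩ := Nat.exists_eq_add_of_le hi'
          exact Or.inr (Or.inl ⟨i, by omega, by rw [he, hrq, add_assoc, hrq]⟩)
      · exact Or.inl (Or.inr he)

/-! ### Counting balanced sequences -/

theorem Finset.card_filter_powerset_union {α : Type*} [DecidableEq α] {A B : Finset α}
    (hAB : Disjoint A B) (a b : ℕ) :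
    ({P ∈ (A ∪ B).powerset | (A ∩ P).card = a ∧ (B ∩ P).card = b}).card =
      A.card.choose a * B.card.choose b := by
  rw [← card_powersetCard a A, ← card_powersetCard b B, ← card_product]
  refine card_bij' (fun P _ => (A ∩ P, B ∩ P)) (fun Q _ => Q.1 ∪ Q.2) ?_ ?_ ?_ ?_
  · intro P hP
    rw [mem_filter] at hP
    rw [mem_product, mem_powersetCard, mem_powersetCard]
    exact ⟨⟨inter_subset_left, hP.2.1⟩, inter_subset_left, hP.2.2⟩
  · rintro ⟨P, Q⟩ hPQ
    rw [mem_product, mem_powersetCard, mem_powersetCard] at hPQ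
    obtain ⟨⟨hP, hPc⟩, hQ, hQc⟩ := hPQ
    have h1 : A ∩ (P ∪ Q) = P := by
      rw [inter_union_distrib_left, inter_eq_right.2 hP,
        disjoint_iff_inter_eq_empty.1 (hAB.mono_right hQ), union_empty]
    have h2 : B ∩ (P ∪ Q) = Q := by
      rw [inter_union_distrib_left, inter_eq_right.2 hQ,
        disjoint_iff_inter_eq_empty.1 (hAB.symm.mono_right hP), empty_union]
    rw [mem_filter, mem_powerset]
    exact ⟨union_subset_union hP hQ, by rw [h1]; exact hPc, by rw [h2]; exact hQc⟩
  · intro P hP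
    rw [mem_filter, mem_powerset] at hP
    simp only
    rw [← union_inter_distrib_right, inter_eq_right.2 hP.1]
  · rintro ⟨P, Q⟩ hPQ
    rw [mem_product, mem_powersetCard, mem_powersetCard] at hPQ
    obtain ⟨⟨hP, -⟩, hQ, -⟩ := hPQ
    refine Prod.ext ?_ ?_
    · simp only
      rw [inter_union_distrib_left, inter_eq_right.2 hP,
        disjoint_iff_inter_eq_empty.1 (hAB.mono_right hQ), union_empty]
    · simp only
      rw [inter_union_distrib_left, inter_eq_right.2 hQ,
        disjoint_iff_inter_eq_empty.1 (hAB.symm.mono_right hP), empty_union]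

theorem Set.ncard_setOf_fst_mem_snd_mem {α β : Type*} (I : Finset α) (S : α → Finset β) {N : ℕ}
    (hN : ∀ i ∈ I, (S i).card = N) : {c : α × β | c.1 ∈ I ∧ c.2 ∈ S c.1}.ncard = I.card * N := by
  have : {c : α × β | c.1 ∈ I ∧ c.2 ∈ S c.1} =
      (fun x : (_ : α) × β => (x.1, x.2)) '' (I.sigma S : Finset ((_ : α) × β)) := by
    ext ⟨i, P⟩
    constructor
    · intro h
      exact ⟨⟨i, P⟩, Finset.mem_coe.2 (Finset.mem_sigma.2 h), rfl⟩
    · rintro ⟨⟨j, Q⟩, h, he⟩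
      obtain ⟨rfl, rfl⟩ := Prod.mk.inj he
      exact Finset.mem_sigma.1 (Finset.mem_coe.1 h)
  rw [this, Set.InjOn.ncard_image, Set.ncard_coe_finset, Finset.card_sigma,
    Finset.sum_congr rfl hN, Finset.sum_const, smul_eq_mul]
  rintro ⟨i, P⟩ - ⟨j, Q⟩ - he
  obtain ⟨rfl, rfl⟩ := Prod.mk.inj he
  rfl

theorem sum_signStep (c : ℕ × Finset ℕ) (A : Finset ℕ) :
    ∑ j ∈ A, signStep c j = 2 * ((A.erase c.1 ∩ c.2).card : ℤ) - (A.erase c.1).card := by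
  have h1 : ∑ j ∈ A, signStep c j = ∑ j ∈ A.erase c.1, signStep c j := by
    symm
    refine Finset.sum_subset (Finset.erase_subset _ _) fun j hj hj' => ?_
    rw [signStep_eq_zero_iff]
    by_contra h
    exact hj' (Finset.mem_erase.2 ⟨h, hj⟩)
  have h2 : ∑ j ∈ A.erase c.1, signStep c j =
      ∑ j ∈ A.erase c.1, (2 * (if j ∈ c.2 then 1 else 0) - 1) := by
    refine Finset.sum_congr rfl fun j hj => ?_
    unfold signStep
    rw [if_neg (Finset.ne_of_mem_erase hj)]
    split_ifs <;> norm_num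
  rw [h1, h2, Finset.sum_sub_distrib, ← Finset.mul_sum, Finset.sum_boole, Finset.filter_mem_eq_inter]
  simp

/-- The sets of plus signs with prescribed numbers of elements on the two sides of the chord. -/
def plusSets (k L a b i : ℕ) : Finset (Finset ℕ) :=
  {P ∈ ((Finset.range k).erase i ∪ (Finset.Ico k L).erase i).powerset |
    ((Finset.range k).erase i ∩ P).card = a ∧ ((Finset.Ico k L).erase i ∩ P).card = b}

theorem card_plusSets (k L a b i : ℕ) : (plusSets k L a b i).card =
    ((Finset.range k).erase i).card.choose a * ((Finset.Ico k L).erase i).card.choose b := by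
  refine Finset.card_filter_powerset_union ?_ a b
  rw [Finset.disjoint_left]
  intro x hx hx'
  have h1 := Finset.mem_range.1 (Finset.mem_of_mem_erase hx)
  have h2 := Finset.mem_Ico.1 (Finset.mem_of_mem_erase hx')
  omega

/-- Splits the cycle at the chord, with the numbers of plus signs on the two arcs as parameters
still to be determined. -/
theorem isBalanced_iff {k l : ℕ} {c : ℕ × Finset ℕ} :
    IsBalanced k (k + l) c ↔
      c.1 < k + l ∧ c.2 ∈ plusSets k (k + l) (((Finset.range k).erase c.1 ∩ c.2).card)
        (((Finset.Ico k (k + l)).erase c.1 ∩ c.2).card) c.1 ∧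
      signHeight c k + ∑ j ∈ Finset.Ico k (k + l), signStep c j = 0 ∧ |signHeight c k| ≤ 1 := by
  have h1 : signHeight c (k + l) = signHeight c k + ∑ j ∈ Finset.Ico k (k + l), signStep c j :=
    (Finset.sum_range_add_sum_Ico _ (Nat.le_add_right k l)).symm
  have h2 : (Finset.range (k + l)).erase c.1 =
      (Finset.range k).erase c.1 ∪ (Finset.Ico k (k + l)).erase c.1 := by
    rw [← Finset.erase_union_distrib, Finset.range_eq_Ico, Finset.range_eq_Ico,
      Finset.Ico_union_Ico_eq_Ico (Nat.zero_le k) (Nat.le_add_right k l)]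
  rw [IsBalanced, h1, h2, plusSets, Finset.mem_filter, Finset.mem_powerset]
  simp only [and_self, and_true]

theorem mem_plusSets_card {k L a b i : ℕ} {P : Finset ℕ} (h : P ∈ plusSets k L a b i) :
    ((Finset.range k).erase i ∩ P).card = a ∧ ((Finset.Ico k L).erase i ∩ P).card = b :=
  (Finset.mem_filter.1 h).2

theorem card_range_erase (k i : ℕ) :
    ((Finset.range k).erase i).card = if i < k then k - 1 else k := by
  simp only [Finset.card_erase_eq_ite, Finset.card_range, Finset.mem_range]

theorem card_Ico_erase (k l i : ℕ) :
    ((Finset.Ico k (k + l)).erase i).card = if k ≤ i ∧ i < k + l then l - 1 else l := by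
  simp only [Finset.card_erase_eq_ite, Nat.card_Ico, Finset.mem_Ico, Nat.add_sub_cancel_left]

/-- An odd arc sums to 0 only if it contains the zero step; then plus and minus signs are equally
many on each arc. -/
theorem balanced_height_zero_eq (a l : ℕ) :
    {c | IsBalanced (2 * a + 1) (2 * a + 1 + 2 * l) c ∧ |signHeight c (2 * a + 1)| = 0} =
      {c | c.1 ∈ Finset.range (2 * a + 1) ∧
        c.2 ∈ plusSets (2 * a + 1) (2 * a + 1 + 2 * l) a l c.1} := by
  ext c
  have h1 := sum_signStep c (Finset.range (2 * a + 1))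
  have h2 := sum_signStep c (Finset.Ico (2 * a + 1) (2 * a + 1 + 2 * l))
  rw [card_range_erase] at h1
  rw [card_Ico_erase] at h2
  simp only [Set.mem_ofPred_eq, isBalanced_iff, Finset.mem_range]
  constructor
  · rintro ⟨⟨hc, hP, h3, -⟩, h4⟩
    rw [abs_eq_zero] at h4
    have h5 := h4
    rw [signHeight, h1] at h5
    rw [h4, h2] at h3
    have h6 : c.1 < 2 * a + 1 := by
      by_contra h6
      rw [if_neg h6] at h5
      omega
    rw [if_pos h6] at h5
    rw [if_neg
      (show ¬ (2 * a + 1 ≤ c.1 ∧ c.1 < 2 * a + 1 + 2 * l) by omega)] at h3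
    refine ⟨h6, ?_⟩
    convert hP using 2 <;> omega
  · rintro ⟨hc, hP⟩
    obtain ⟨h3, h4⟩ := mem_plusSets_card hP
    rw [if_pos hc] at h1
    rw [if_neg
      (show ¬ (2 * a + 1 ≤ c.1 ∧ c.1 < 2 * a + 1 + 2 * l) by omega)] at h2
    have h5 : signHeight c (2 * a + 1) = 0 := by
      rw [signHeight, h1, h3]; push_cast; omega
    refine ⟨⟨by omega, by rwa [h3, h4], ?_, by rw [h5]; norm_num⟩, by rw [h5]; norm_num⟩
    rw [h5, h2, h4]
    push_cast; omega

/-- An odd arc sums to `±1` only if the zero step lies on the other arc, which must then sum to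
`∓1`; the two plus-sets are the two signs. -/
theorem balanced_height_one_eq (a l : ℕ) :
    {c | IsBalanced (2 * a + 1) (2 * a + 1 + 2 * (l + 1)) c ∧ |signHeight c (2 * a + 1)| = 1} =
      {c | c.1 ∈ Finset.Ico (2 * a + 1) (2 * a + 1 + 2 * (l + 1)) ∧
        c.2 ∈ plusSets (2 * a + 1) (2 * a + 1 + 2 * (l + 1)) (a + 1) l c.1 ∪
          plusSets (2 * a + 1) (2 * a + 1 + 2 * (l + 1)) a (l + 1) c.1} := by
  ext c
  have h1 := sum_signStep c (Finset.range (2 * a + 1))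
  have h2 := sum_signStep c (Finset.Ico (2 * a + 1) (2 * a + 1 + 2 * (l + 1)))
  rw [card_range_erase] at h1
  rw [card_Ico_erase] at h2
  simp only [Set.mem_ofPred_eq, isBalanced_iff, Finset.mem_Ico, Finset.mem_union]
  constructor
  · rintro ⟨⟨hc, hP, h3, -⟩, h4⟩
    have h5 : signHeight c (2 * a + 1) = _ := h1
    have h6 : ¬ c.1 < 2 * a + 1 := by
      intro h6
      rw [if_pos h6] at h5
      rcases (abs_eq zero_le_one).1 h4 with h7 | h7 <;> omega
    rw [if_neg h6] at h5
    rw [h2, if_pos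
      (show 2 * a + 1 ≤ c.1 ∧ c.1 < 2 * a + 1 + 2 * (l + 1) by omega)] at h3
    refine ⟨by omega, ?_⟩
    rcases (abs_eq zero_le_one).1 h4 with h7 | h7
    · left
      convert hP using 2 <;> omega
    · right
      convert hP using 2 <;> omega
  · rintro ⟨hc, hP⟩
    have h5 : signHeight c (2 * a + 1) = _ := h1
    rw [if_neg (show ¬ c.1 < 2 * a + 1 by omega)] at h5
    rw [if_pos
      (show 2 * a + 1 ≤ c.1 ∧ c.1 < 2 * a + 1 + 2 * (l + 1) by omega)] at h2
    rcases hP with hP | hP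
    · obtain ⟨h3, h4⟩ := mem_plusSets_card hP
      have h6 : signHeight c (2 * a + 1) = 1 := by rw [h5, h3]; push_cast; omega
      refine ⟨⟨by omega, by rwa [h3, h4], ?_, by rw [h6]; norm_num⟩, by rw [h6]; norm_num⟩
      rw [h6, h2, h4]
      omega
    · obtain ⟨h3, h4⟩ := mem_plusSets_card hP
      have h6 : signHeight c (2 * a + 1) = -1 := by rw [h5, h3]; push_cast; omega
      refine ⟨⟨by omega, by rwa [h3, h4], ?_, by rw [h6]; norm_num⟩, by rw [h6]; norm_num⟩
      rw [h6, h2, h4]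
      omega

theorem ncard_balanced_height_zero (a l : ℕ) :
    {c | IsBalanced (2 * a + 1) (2 * a + 1 + 2 * l) c ∧ |signHeight c (2 * a + 1)| = 0}.ncard =
      (2 * a + 1) * (Nat.choose (2 * a) a * Nat.choose (2 * l) l) := by
  rw [balanced_height_zero_eq, Set.ncard_setOf_fst_mem_snd_mem, Finset.card_range]
  intro i hi
  rw [Finset.mem_range] at hi
  rw [card_plusSets, card_range_erase, card_Ico_erase, if_pos hi, if_neg (by omega)]
  rfl

theorem ncard_balanced_height_one (a l : ℕ) :
    {c | IsBalanced (2 * a + 1) (2 * a + 1 + 2 * (l + 1)) c ∧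
        |signHeight c (2 * a + 1)| = 1}.ncard =
      (2 * (l + 1)) *
        (Nat.choose (2 * a + 1) (a + 1) * Nat.choose (2 * (l + 1)) (l + 1)) := by
  rw [balanced_height_one_eq, Set.ncard_setOf_fst_mem_snd_mem _ (fun i =>
    plusSets (2 * a + 1) (2 * a + 1 + 2 * (l + 1)) (a + 1) l i ∪
      plusSets (2 * a + 1) (2 * a + 1 + 2 * (l + 1)) a (l + 1) i), Nat.card_Ico,
    Nat.add_sub_cancel_left]
  intro i hi
  rw [Finset.mem_Ico] at hi
  rw [Finset.card_union_of_disjoint, card_plusSets, card_plusSets, card_range_erase, card_Ico_erase,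
    if_neg (by omega), if_pos hi]
  · have h1 : Nat.choose (2 * a + 1) a = Nat.choose (2 * a + 1) (a + 1) :=
      Nat.choose_symm_of_eq_add (by omega)
    have h2 : 2 * (l + 1) = (2 * l + 1) + 1 := by ring
    rw [h1, ← mul_add, h2, Nat.add_sub_cancel, ← Nat.choose_succ_succ]
  · rw [Finset.disjoint_left]
    intro P h1 h2
    have h3 := mem_plusSets_card h1
    have h4 := mem_plusSets_card h2
    omega

theorem finite_isBalanced (k L : ℕ) : {c | IsBalanced k L c}.Finite := by
  refine (Finset.finite_toSet (Finset.range L ×ˢ (Finset.range L).powerset)).subset ?_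
  rintro c ⟨h1, h2, -⟩
  rw [Finset.mem_coe, Finset.mem_product, Finset.mem_range, Finset.mem_powerset]
  exact ⟨h1, h2.trans (Finset.erase_subset _ _)⟩

theorem ncard_isBalanced (k L : ℕ) :
    {c | IsBalanced k L c}.ncard =
      {c | IsBalanced k L c ∧ |signHeight c k| = 0}.ncard +
        {c | IsBalanced k L c ∧ |signHeight c k| = 1}.ncard := by
  rw [← Set.ncard_union_eq (hs := (finite_isBalanced k L).subset fun c hc => hc.1)
    (ht := (finite_isBalanced k L).subset fun c hc => hc.1)]
  · congr 1
    ext c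
    constructor
    · intro hc
      have h1 := hc.2.2.2
      have h2 := abs_nonneg (signHeight c k)
      have h3 : |signHeight c k| = 0 ∨ |signHeight c k| = 1 := by omega
      exact h3.imp (fun h => ⟨hc, h⟩) fun h => ⟨hc, h⟩
    · rintro (h | h) <;> exact h.1
  · rw [Set.disjoint_left]
    rintro c ⟨-, h1⟩ ⟨-, h2⟩
    omega

/-! ### The facet count -/

theorem mainTheorem9 {V : Type*} [Fintype V] [DecidableEq V] (G : SimpleGraph V)
    (m₁ m₂ : ℕ) (hm₁ : 2 ≤ m₁) (hm₂ : 1 ≤ m₂)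
    (hG : IsCycleEdgeJoin G (2 * m₁) (2 * m₂ + 1)) :
    (configFacets (adjacencyConfig G)).ncard =
      ((2 * m₁ - 1) * Nat.choose (2 * m₁ - 2) (m₁ - 1)
        + (2 * m₂) * Nat.choose (2 * m₁ - 1) m₁) * Nat.choose (2 * m₂) m₂ ∧
    (∀ F ∈ configFacets (adjacencyConfig G), configCorank F = 0 ∨ configCorank F = 1) ∧
    {F ∈ configFacets (adjacencyConfig G) | configCorank F = 0}.ncard =
      (2 * m₁ - 1) * Nat.choose (2 * m₁ - 2) (m₁ - 1) * Nat.choose (2 * m₂) m₂ ∧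
    {F ∈ configFacets (adjacencyConfig G) | configCorank F = 1}.ncard =
      (2 * m₂) * Nat.choose (2 * m₁ - 1) m₁ * Nat.choose (2 * m₂) m₂ := by
  -- With these substitutions the first arc has `2 * (a + 1) + 1 = 2m₁ - 1` edges and the second `2
  -- * (l + 1) = 2m₂`, the shapes used in the counts.
  obtain ⟨a, rfl⟩ : ∃ a, m₁ = a + 1 + 1 := ⟨m₁ - 2, by omega⟩
  obtain ⟨l, rfl⟩ : ∃ l, m₂ = l + 1 := ⟨m₂ - 1, by omega⟩
  have e1 : 2 * (a + 1 + 1) = (2 * a + 1) + 3 := by ring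
  have e2 : 2 * (l + 1) + 1 = 2 * l + 3 := by ring
  rw [e1, e2] at hG
  obtain ⟨r, hr⟩ := hG.exists_isChordedCycle
  have e3 : 2 * a + 1 + 2 = 2 * (a + 1) + 1 := by ring
  have e4 : 2 * l + 2 = 2 * (l + 1) := by ring
  rw [e3, e4] at hr
  have hL : Odd (2 * (a + 1) + 1 + 2 * (l + 1)) := ⟨a + 1 + (l + 1), by ring⟩
  have hne := hr.nontrivial.to_nonempty
  have f1 : 2 * (a + 1 + 1) - 1 = 2 * (a + 1) + 1 := by omega
  have f2 : 2 * (a + 1 + 1) - 2 = 2 * (a + 1) := by omega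
  have f3 : a + 1 + 1 - 1 = a + 1 := by omega
  rw [f1, f2, f3]
  refine ⟨?_, ?_, ?_, ?_⟩
  · rw [hr.ncard_configFacets hL, ncard_isBalanced, ncard_balanced_height_zero,
      ncard_balanced_height_one]
    ring
  · intro F hF
    rw [hr.configFacets_eq_image hL] at hF
    obtain ⟨c, hc, rfl⟩ := hF
    simp only
    rw [hr.configCorank_tightSet hc]
    have h1 := hc.2.2.2
    have h2 := abs_nonneg (signHeight c (2 * (a + 1) + 1))
    omega
  · rw [hr.ncard_configFacets_corank hL, ncard_balanced_height_zero]
    ring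
  · rw [hr.ncard_configFacets_corank hL, ncard_balanced_height_one]
    ring
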